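/- Let $\mathcal H=\mathbb C^{n_1}\otimes\cdots\otimes\mathbb C^{n_d}$. For each $i$ let $S^{(i)}_0,\dots,S^{(i)}_{t_i}$ be Hermitian matrices forming a basis of the space of complex $n_i\times n_i$ matrices that is orthogonal for $\operatorname{tr}(A^\dagger B)$, with $S^{(i)}_0$ the identity. Let $\rho$ be a state on $\mathcal H$ (positive semidefinite, trace one). Then $\rho$ has a unique expansion $$\rho=\mathcal N\sum_{\mu_1,\dots,\mu_d}X_{\mu_1\dots\mu_d}\,S^{(1)}_{\mu_1}\otimes\cdots\otimes S^{(d)}_{\mu_d},\qquad \mathcal N=\prod_{i=1}^d\frac1{\sqrt{t_i+1}},$$ with real coordinates $X_{\mu_1\dots\mu_d}$. Put $n=\sum_i t_i$, write points of $\mathbb R^n$ as $x=(x^{(i)}_a)_{1\le i\le d,\,1\le a\le t_i}$, set $x^{(i)}_0=1$, and let $$K=K^{(1)}\times\cdots\times K^{(d)},\qquad K^{(i)}=\Big\{y\in\mathbb R^{t_i}:\ S^{(i)}_0+\sum_{a=1}^{t_i}y_aS^{(i)}_a\ge 0\Big\}.$$ Then $K$ is compact, and there are finitely many polynomials $g_1,\dots,g_m$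 with $K=\{x\in\mathbb R^n: g_1(x)\ge0,\dots,g_m(x)\ge0\}$. Fix any such $g_1,\dots,g_m$. Let $\mathcal A\subset\mathbb N^n$ be the set of exponents $\alpha$ with $x^\alpha=x^{(1)}_{\mu_1}\cdots x^{(d)}_{\mu_d}$ for some tuple $(\mu_1,\dots,\mu_d)$, $0\le\mu_i\le t_i$, and put $y_\alpha=X_{\mu_1\dots\mu_d}$ for $\alpha$ belonging to $(\mu_1,\dots,\mu_d)$. For a real family $z=(z_\beta)_{|\beta|\le 2k}$ and $j\le k$ let $M_j(z)=(z_{\alpha+\beta})_{|\alpha|,|\beta|\le j}$. For a polynomial $g=\sum_\gamma g_\gamma x^\gamma$ let $d_g=\lceil\deg(g)/2\rceil$ and $(g\star z)_\alpha=\sum_\gamma g_\gamma z_{\alpha+\gamma}$, and for $k\ge d_g$ let $M_{k-d_g}(g\star z)=((g\star z)_{\alpha+\beta})_{|\alpha|,|\beta|\le k-d_g}$. Let $d_0=\max\{1,d_{g_1},\dots,d_{g_m}\}$. Then $\rho$ is separable, i.e. $\rho=\sum_j w_j\,\rho^{(1)}_j\otimes\cdots\otimes\rho^{(d)}_j$ is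 a finite sum with $w_j\ge0$ and each $\rho^{(i)}_j$ a density matrix on $\mathbb C^{n_i}$, if and only if there are an integer $k$ with $2k>d$ and $k\ge d_0$ and a real family $z=(z_\beta)_{|\beta|\le 2k}$ such that 1. $z_\alpha=y_\alpha$ for all $\alpha\in\mathcal A$, 2. $\operatorname{rank}M_k(z)=\operatorname{rank}M_{k-d_0}(z)$, 3. $M_k(z)\ge0$ and $M_{k-d_{g_i}}(g_i\star z)\ge0$ for $i=1,\dots,m$. -/

import Mathlib

open scoped BigOperators ComplexOrder

/-! ### States, separability and product operator bases -/

/-- A density matrix: positive semidefinite (in particular Hermitian) with unit trace. -/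
def IsDensityMatrix {ι : Type*} [Fintype ι] (ρ : Matrix ι ι ℂ) : Prop :=
  ρ.PosSemidef ∧ ρ.trace = 1

/-- The tensor product `A₁ ⊗ ⋯ ⊗ A_d` of matrices `A i` acting on `ℂ ^ (n i)`, as a matrix on
`ℂ^(n 1) ⊗ ⋯ ⊗ ℂ^(n d)`, whose product basis is indexed by tuples. -/
def tensorMatrix {d : ℕ} {n : Fin d → ℕ} (A : ∀ i, Matrix (Fin (n i)) (Fin (n i)) ℂ) :
    Matrix (∀ i, Fin (n i)) (∀ i, Fin (n i)) ℂ :=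
  Matrix.of fun p q => ∏ i, A i (p i) (q i)

/-- Separability: `ρ = ∑ j, w j • ρ_j^(1) ⊗ ⋯ ⊗ ρ_j^(d)`, a finite sum with `w j ≥ 0` and density
matrices `ρ_j^(i)`. -/
def IsSeparableState {d : ℕ} {n : Fin d → ℕ}
    (ρ : Matrix (∀ i, Fin (n i)) (∀ i, Fin (n i)) ℂ) : Prop :=
  ∃ (r : ℕ) (w : Fin r → ℝ) (σ : Fin r → ∀ i, Matrix (Fin (n i)) (Fin (n i)) ℂ),
    (∀ j, 0 ≤ w j) ∧ (∀ j i, IsDensityMatrix (σ j i)) ∧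
      ρ = ∑ j, (w j : ℂ) • tensorMatrix (σ j)

/-- `S_0, …, S_t` is a basis of the space of all complex `N × N` matrices that consists of
Hermitian matrices, is orthogonal for `tr (A† B)`, and starts with the identity matrix. -/
structure IsHermitianOperatorBasis {N t : ℕ} (S : Fin (t + 1) → Matrix (Fin N) (Fin N) ℂ) :
    Prop where
  isHermitian : ∀ μ, (S μ).IsHermitian
  zero_eq_one : S 0 = 1
  orthogonal : ∀ μ ν, μ ≠ ν → ((S μ).conjTranspose * S ν).trace = 0
  linearIndependent : LinearIndependent ℂ S
  span_eq_top : Submodule.span ℂ (Set.range S) = ⊤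

/-- The operator `𝒩 ∑_μ X_{μ₁…μ_d} S^(1)_{μ₁} ⊗ ⋯ ⊗ S^(d)_{μ_d}` with
`𝒩 = ∏ i, 1 / √(t i + 1)`. -/
noncomputable def operatorOfCoords {d : ℕ} {n t : Fin d → ℕ}
    (S : ∀ i, Fin (t i + 1) → Matrix (Fin (n i)) (Fin (n i)) ℂ)
    (X : (∀ i, Fin (t i + 1)) → ℝ) : Matrix (∀ i, Fin (n i)) (∀ i, Fin (n i)) ℂ :=
  ((∏ i, 1 / Real.sqrt ((t i : ℝ) + 1) : ℝ) : ℂ) •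
    ∑ μ : ∀ i, Fin (t i + 1), (X μ : ℂ) • tensorMatrix fun i => S i (μ i)

/-! ### The compact set `K` and the index set `𝒜` -/

/-- The local state space in coordinates: all `y = (y_1, …, y_t)` such that
`S_0 + ∑_a y_a S_a ≥ 0` (the coordinate `y_0` is `1`). -/
def localStateSet {N t : ℕ} (S : Fin (t + 1) → Matrix (Fin N) (Fin N) ℂ) : Set (Fin t → ℝ) :=
  {y | (S 0 + ∑ a : Fin t, (y a : ℂ) • S a.succ).PosSemidef}

/-- The product `K = K^(1) × ⋯ × K^(d)`. The variable `x^(i)_{a+1}` carries the label `⟨i, a⟩`. -/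
def productStateSet {d : ℕ} {n t : Fin d → ℕ}
    (S : ∀ i, Fin (t i + 1) → Matrix (Fin (n i)) (Fin (n i)) ℂ) :
    Set ((Σ i : Fin d, Fin (t i)) → ℝ) :=
  {x | ∀ i, (fun a => x ⟨i, a⟩) ∈ localStateSet (S i)}

/-- The exponent `α` with `x^(1)_{μ₁} ⋯ x^(d)_{μ_d} = x^α`, where `x^(i)_0 = 1`. -/
noncomputable def coordExponent {d : ℕ} {t : Fin d → ℕ} (μ : ∀ i, Fin (t i + 1)) :
    (Σ i : Fin d, Fin (t i)) →₀ ℕ :=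
  ∑ i, Fin.cases (motive := fun _ => (Σ i : Fin d, Fin (t i)) →₀ ℕ) 0
    (fun a => Finsupp.single ⟨i, a⟩ 1) (μ i)

/-- The index set `𝒜` of all exponents that belong to some tuple `(μ₁, …, μ_d)`. -/
def coordExponents {d : ℕ} (t : Fin d → ℕ) : Set ((Σ i : Fin d, Fin (t i)) →₀ ℕ) :=
  Set.range (coordExponent (t := t))

/-! ### Truncated moment sequences -/

/-- The exponents `α` with `|α| ≤ k`. -/
abbrev ExponentsLE (σ : Type*) (k : ℕ) : Type _ := {α : σ →₀ ℕ // α.degree ≤ k}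

noncomputable instance ExponentsLE.instFintype {σ : Type*} [Finite σ] (k : ℕ) : Fintype (ExponentsLE σ k) :=
  have : Finite (ExponentsLE σ k) := (Finsupp.finite_of_degree_le k).to_subtype
  Fintype.ofFinite _

/-- The moment matrix `M_k(z)_{αβ} = z_{α+β}`, `|α|, |β| ≤ k`, of a sequence indexed by exponents.
Only the entries of `z` of degree at most `2 k` enter. -/
noncomputable def momentMatrix {σ : Type*} (k : ℕ) (z : (σ →₀ ℕ) → ℝ) :
    Matrix (ExponentsLE σ k) (ExponentsLE σ k) ℝ :=
  Matrix.of fun α β => z (α.1 + β.1)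

/-- The shifted sequence `(g ⋆ z)_α = ∑_γ g_γ z_{α+γ}`. -/
noncomputable def shiftedSeq {σ : Type*} (g : MvPolynomial σ ℝ) (z : (σ →₀ ℕ) → ℝ) :
    (σ →₀ ℕ) → ℝ :=
  fun α => ∑ γ ∈ g.support, g.coeff γ * z (α + γ)

/-- `d_g = ⌈deg g / 2⌉`. -/
noncomputable def halfDegree {σ : Type*} (g : MvPolynomial σ ℝ) : ℕ :=
  ⌈(g.totalDegree : ℚ) / 2⌉₊

/-- `d_0 = max {1, d_{g_1}, …, d_{g_m}}`. -/
noncomputable def flatOrder {σ : Type*} {m : ℕ} (g : Fin m → MvPolynomial σ ℝ) : ℕ :=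
  max 1 (Finset.univ.sup fun i => halfDegree (g i))

/-- The basic closed semi-algebraic set `{x | g_1(x) ≥ 0, …, g_m(x) ≥ 0}`. -/
def basicClosedSet {σ : Type*} {m : ℕ} (g : Fin m → MvPolynomial σ ℝ) : Set (σ → ℝ) :=
  {x | ∀ i, 0 ≤ MvPolynomial.eval x (g i)}

/-- A truncated moment sequence with index set `𝒜`: one real number for each exponent in `𝒜`. -/
abbrev TruncSeq {σ : Type*} (A : Set (σ →₀ ℕ)) : Type _ := A → ℝ

/-- A truncated moment sequence of degree `D`: one real number for each exponent `|α| ≤ D`. -/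
abbrev TruncSeqLE (σ : Type*) (D : ℕ) : Type _ := ExponentsLE σ D → ℝ

/-- A sequence of degree `D` as a function on all exponents. The values `0` put in above degree `D`
are never read by moment matrices of order `k ≤ D / 2` and localizing matrices of order `k` with
`d_g ≤ k ≤ D / 2`. -/
noncomputable def TruncSeqLE.val {σ : Type*} {D : ℕ} (z : TruncSeqLE σ D) : (σ →₀ ℕ) → ℝ :=
  fun α => if h : α.degree ≤ D then z ⟨α, h⟩ else 0

/-- `z`, of degree `2k > D`, is a flat extension of the sequence `y` (whose index set consists of
exponents of degree at most `D`), relative to the polynomials `g_1, …, g_m`: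
`z_α = y_α` on the index set, and `rank M_k(z) = rank M_{k-d_0}(z)`, where `d_0 ≤ k`. -/
structure IsFlatExtension {σ : Type*} [Finite σ] {A : Set (σ →₀ ℕ)} {m k : ℕ} (D : ℕ)
    (g : Fin m → MvPolynomial σ ℝ) (y : TruncSeq A) (z : TruncSeqLE σ (2 * k)) : Prop where
  degree_lt : D < 2 * k
  extends_eq : ∀ α : A, z.val α = y α
  order_le : flatOrder g ≤ k
  rank_eq : (momentMatrix k z.val).rank = (momentMatrix (k - flatOrder g) z.val).rank

/-! ### Flat extensions of truncated moment sequences -/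

/-! By the Bloch parametrization, points of $K$ correspond to tuples of local density matrices, and
the coordinates of the resulting product state are the monomials $x^\alpha$, $\alpha\in\mathcal A$.
As coordinates are unique, $\rho$ is separable iff $y_\alpha=\sum_j w_j x_j^\alpha$ on $\mathcal A$
for finitely many $x_j\in K$ and $w_j\ge0$ (`isSeparableState_operatorOfCoords_iff`). What remains
is a truncated moment problem on $K$.

If $z$ satisfies the three conditions, write $M_k(z)$ as a Gram matrix of vectors $v_\alpha$.
Flatness says that those with $|\alpha|\le k-d_0$ already span. Since $d_0\ge1$, multiplication by
each variable, $v_\alpha\mapsto v_{\alpha+e_i}$, is then well defined on the whole space. The Hankel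
structure makes these operators symmetric and commuting, so they are simultaneously diagonalizable:
joint eigenvalues are the atoms, and the squared norms of the components of $v_0$ are the weights
(`exists_atoms_of_gram`). Spanning in degree $k-d_0$ also gives interpolation polynomials of that
degree at the atoms. Testing $M_{k-d_{g_i}}(g_i\star z)$ on them isolates one atom at a time and
yields $g_i\ge0$ there (`exists_atoms_mem_of_flat`).

Conversely, the moment matrices of $r$ atoms have rank at most $r$ in every order, and the rank
grows with the order. It therefore stabilizes, and every large $k$ gives a flat extension
(`exists_flat_of_atoms`). -/

section FlatExtension

variable {σ : Type*}

/-- The value `x ^ α` of the monomial with exponent `α` at the point `x`. -/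
noncomputable def monomialEval (x : σ → ℝ) (α : σ →₀ ℕ) : ℝ :=
  α.prod fun i e => x i ^ e

lemma monomialEval_zero (x : σ → ℝ) : monomialEval x 0 = 1 := by
  simp [monomialEval]

lemma monomialEval_add (x : σ → ℝ) (α β : σ →₀ ℕ) :
    monomialEval x (α + β) = monomialEval x α * monomialEval x β := by
  classical
  exact Finsupp.prod_add_index' (by simp) (by intros; rw [pow_add])

lemma monomialEval_single (x : σ → ℝ) (i : σ) : monomialEval x (Finsupp.single i 1) = x i := by
  simp [monomialEval]

lemma eval_eq_sum_monomialEval (x : σ → ℝ) (g : MvPolynomial σ ℝ) :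
    MvPolynomial.eval x g = ∑ γ ∈ g.support, g.coeff γ * monomialEval x γ := by
  rw [MvPolynomial.eval_eq]
  rfl

/-- This makes every moment of degree at most $2k$ an entry of the moment matrix of order $k$. -/
lemma Finsupp.exists_add_of_degree_le (k l : ℕ) (γ : σ →₀ ℕ) (h : γ.degree ≤ k + l) :
    ∃ α β : σ →₀ ℕ, α.degree ≤ k ∧ β.degree ≤ l ∧ α + β = γ := by
  induction k generalizing γ with
  | zero => exact ⟨0, γ, by simp, by simpa using h, by simp⟩
  | succ k ih =>
    by_cases hγ : γ = 0
    · exact ⟨0, 0, by simp, by simp, by simp [hγ]⟩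
    obtain ⟨i, hi⟩ := Finsupp.ne_iff.mp hγ
    have hle : Finsupp.single i 1 ≤ γ := by
      rw [Finsupp.single_le_iff]
      exact Nat.one_le_iff_ne_zero.mpr hi
    obtain ⟨δ, rfl⟩ := exists_add_of_le hle
    rw [map_add, Finsupp.degree_single] at h
    obtain ⟨α, β, hα, hβ, rfl⟩ := ih δ (by omega)
    refine ⟨Finsupp.single i 1 + α, β, ?_, hβ, by rw [add_assoc]⟩
    rw [map_add, Finsupp.degree_single]
    omega

lemma Finsupp.exists_single_add_of_ne_zero {α : σ →₀ ℕ} (h : α ≠ 0) :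
    ∃ i β, α = β + Finsupp.single i 1 ∧ α.degree = β.degree + 1 := by
  obtain ⟨i, hi⟩ := Finsupp.ne_iff.mp h
  have hle : Finsupp.single i 1 ≤ α := by
    rw [Finsupp.single_le_iff]
    exact Nat.one_le_iff_ne_zero.mpr hi
  obtain ⟨δ, rfl⟩ := exists_add_of_le hle
  refine ⟨i, δ, add_comm _ _, ?_⟩
  rw [map_add, Finsupp.degree_single, add_comm]

variable {H : Type*} [NormedAddCommGroup H] [InnerProductSpace ℝ H]

lemma eq_of_inner_eq_of_span {ι : Type*} {s : Set ι} {v : ι → H}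
    (hspan : Submodule.span ℝ (v '' s) = ⊤) {x y : H}
    (h : ∀ a ∈ s, inner ℝ x (v a) = inner ℝ y (v a)) : x = y := by
  refine ext_inner_right ℝ fun w => ?_
  have hw : w ∈ Submodule.span ℝ (v '' s) := hspan ▸ Submodule.mem_top
  induction hw using Submodule.span_induction with
  | mem w hw =>
    obtain ⟨a, ha, rfl⟩ := hw
    exact h a ha
  | zero => simp
  | add a b _ _ ha hb => rw [inner_add_right, inner_add_right, ha, hb]
  | smul c a _ ha => rw [inner_smul_right, inner_smul_right, ha]

/-- Multiplication by the variable `x_i`, on vectors whose Gram matrix is a flat moment matrix. -/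
lemma exists_multiplication_operator {k : ℕ} {z : (σ →₀ ℕ) → ℝ} {v : (σ →₀ ℕ) → H}
    (hv : ∀ α β, α.degree ≤ k + 1 → β.degree ≤ k + 1 → inner ℝ (v α) (v β) = z (α + β))
    (hspan : Submodule.span ℝ (v '' {α | α.degree ≤ k}) = ⊤) (i : σ) :
    ∃ T : H →ₗ[ℝ] H, ∀ α, α.degree ≤ k → T (v α) = v (α + Finsupp.single i 1) := by
  have hdeg : ∀ α : σ →₀ ℕ, α.degree ≤ k → (α + Finsupp.single i 1).degree ≤ k + 1 := by
    intro α hα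
    rw [map_add, Finsupp.degree_single]
    omega
  let e := Finsupp.linearCombination ℝ fun α : {α : σ →₀ ℕ // α.degree ≤ k} => v α.1
  let e' := Finsupp.linearCombination ℝ
    fun α : {α : σ →₀ ℕ // α.degree ≤ k} => v (α.1 + Finsupp.single i 1)
  -- The shift respects linear relations: in an inner product with $v_\beta$, $|\beta|\le k$, it can
  -- be moved onto $\beta$, and $\beta+e_i$ still has degree at most $k+1$.
  have hker : ∀ c, e c = 0 → e' c = 0 := by
    intro c hc
    refine eq_of_inner_eq_of_span hspan fun β hβ => ?_
    have : inner ℝ (e' c) (v β) = inner ℝ (e c) (v (β + Finsupp.single i 1)) := by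
      simp only [e, e', Finsupp.linearCombination_apply, Finsupp.sum, sum_inner, inner_smul_left]
      refine Finset.sum_congr rfl fun α _ => ?_
      have hβ' : β.degree ≤ k := hβ
      rw [hv _ _ (hdeg _ α.2) (by omega), hv _ _ (by have := α.2; omega) (hdeg _ hβ),
        add_right_comm, add_assoc]
    rw [this, hc, inner_zero_left, inner_zero_left]
  have hsurj : LinearMap.range e = ⊤ := by
    rw [Finsupp.range_linearCombination, ← hspan]
    congr 1
    ext x
    simp
  -- Any linear section of `e` serves, since by `hker` the choice of preimage does not affect `e'`.
  obtain ⟨f, hf⟩ := e.exists_rightInverse_of_surjective hsurj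
  refine ⟨e' ∘ₗ f, fun α hα => ?_⟩
  have h1 : e (f (v α) - Finsupp.single ⟨α, hα⟩ 1) = 0 := by
    have := LinearMap.congr_fun hf (v α)
    simp only [LinearMap.comp_apply, LinearMap.id_apply] at this
    rw [map_sub, this]
    simp [e]
  have h2 := hker _ h1
  rw [map_sub, sub_eq_zero] at h2
  simp only [LinearMap.comp_apply, h2]
  simp [e']

/-- Vectors whose Gram matrix is a flat moment matrix: the moments are those of a finite atomic
measure, and there are interpolation polynomials of low degree at the atoms. -/
theorem exists_atoms_of_gram [Finite σ] [FiniteDimensional ℝ H] {j k : ℕ} (hjk : j ≤ k)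
    {z : (σ →₀ ℕ) → ℝ} {v : (σ →₀ ℕ) → H}
    (hv : ∀ α β, α.degree ≤ k + 1 → β.degree ≤ k + 1 → inner ℝ (v α) (v β) = z (α + β))
    (hspan : Submodule.span ℝ (v '' {α | α.degree ≤ j}) = ⊤) :
    ∃ (F : Finset (σ → ℝ)) (w : (σ → ℝ) → ℝ), (∀ x ∈ F, 0 < w x) ∧
      (∀ γ, γ.degree ≤ 2 * (k + 1) → z γ = ∑ x ∈ F, w x * monomialEval x γ) ∧
      ∀ x ∈ F, ∃ c : ExponentsLE σ j → ℝ, ∑ α, c α * monomialEval x α = 1 ∧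
        ∀ y ∈ F, y ≠ x → ∑ α, c α * monomialEval y α = 0 := by
  classical
  have hspan' : Submodule.span ℝ (v '' {α | α.degree ≤ k}) = ⊤ :=
    top_le_iff.mp (hspan ▸ Submodule.span_mono (Set.image_mono fun α hα => le_trans hα hjk))
  choose T hT using exists_multiplication_operator hv hspan'
  have hdeg : ∀ (i : σ) (α : σ →₀ ℕ), α.degree ≤ k →
      (α + Finsupp.single i 1).degree ≤ k + 1 := by
    intro i α hα
    rw [map_add, Finsupp.degree_single]
    omega
  have hinner : ∀ i α x, α.degree ≤ k →
      inner ℝ (T i x) (v α) = inner ℝ x (v (α + Finsupp.single i 1)) := by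
    intro i α x hα
    have hx : x ∈ Submodule.span ℝ (v '' {α | α.degree ≤ k}) := hspan' ▸ Submodule.mem_top
    induction hx using Submodule.span_induction with
    | mem w hw =>
      obtain ⟨β, hβ, rfl⟩ := hw
      have hβ' : β.degree ≤ k := hβ
      rw [hT i β hβ, hv _ _ (hdeg i β hβ) (by omega), hv _ _ (by omega) (hdeg i α hα),
        add_right_comm, add_assoc]
    | zero => simp
    | add a b _ _ ha hb => rw [map_add, inner_add_left, inner_add_left, ha, hb]
    | smul c a _ ha => rw [map_smul, inner_smul_left, inner_smul_left, ha]
  have hsymm : ∀ i, (T i).IsSymmetric := by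
    intro i x y
    have hy : y ∈ Submodule.span ℝ (v '' {α | α.degree ≤ k}) := hspan' ▸ Submodule.mem_top
    induction hy using Submodule.span_induction with
    | mem w hw =>
      obtain ⟨β, hβ, rfl⟩ := hw
      rw [hinner i β x hβ, hT i β hβ]
    | zero => simp
    | add a b _ _ ha hb => rw [map_add, inner_add_right, inner_add_right, ha, hb]
    | smul c a _ ha => rw [map_smul, inner_smul_right, inner_smul_right, ha]
  have hcomm' : ∀ i l x, T i (T l x) = T l (T i x) := by
    intro i l x
    have hx : x ∈ Submodule.span ℝ (v '' {α | α.degree ≤ k}) := hspan' ▸ Submodule.mem_top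
    induction hx using Submodule.span_induction with
    | mem w hw =>
      obtain ⟨α, hα, rfl⟩ := hw
      refine eq_of_inner_eq_of_span hspan' fun β hβ => ?_
      rw [hinner _ _ _ hβ, hinner _ _ _ hβ, hT _ _ hα, hT _ _ hα,
        hv _ _ (hdeg _ _ hα) (hdeg _ _ hβ), hv _ _ (hdeg _ _ hα) (hdeg _ _ hβ)]
      congr 1
      abel
    | zero => simp
    | add a b _ _ ha hb => simp only [map_add, ha, hb]
    | smul c a _ ha => simp only [map_smul, ha]
  have hcomm : Pairwise (Function.onFun Commute T) := fun i l _ =>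
    LinearMap.ext fun x => hcomm' i l x
  -- The spectral theorem for commuting symmetric operators. The joint eigenvalues $\chi$ are points
  -- of $\mathbb R^\sigma$, and the components `u x` of $v_0$ are pairwise orthogonal.
  have htop := LinearMap.IsSymmetric.iSup_iInf_eq_top_of_commute hsymm hcomm
  have horth := LinearMap.IsSymmetric.orthogonalFamily_iInf_eigenspaces hsymm
  have h0 : v 0 ∈ ⨆ χ : σ → ℝ, ⨅ i, Module.End.eigenspace (T i) (χ i) :=
    htop ▸ Submodule.mem_top
  rw [Submodule.mem_iSup_iff_exists_finsupp] at h0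
  obtain ⟨u, hu, hsum⟩ := h0
  have huu : ∀ x y, x ≠ y → inner ℝ (u x) (u y) = 0 := fun x y hxy =>
    horth hxy ⟨u x, hu x⟩ ⟨u y, hu y⟩
  have hTu : ∀ i x, T i (u x) = x i • u x := fun i x =>
    Module.End.mem_eigenspace_iff.mp ((Submodule.mem_iInf _).mp (hu x) i)
  -- Here $v_\alpha=T^\alpha v_0$, and $T^\alpha$ acts on the component `u x` as the scalar
  -- $x^\alpha$.
  have hvα : ∀ n, ∀ α : σ →₀ ℕ, α.degree = n → n ≤ k + 1 →
      v α = ∑ x ∈ u.support, monomialEval x α • u x := by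
    intro n
    induction n with
    | zero =>
      intro α hα _
      rw [Finsupp.degree_eq_zero_iff] at hα
      rw [hα, ← hsum, Finsupp.sum]
      simp [monomialEval_zero]
    | succ n ih =>
      intro α hα hn
      have hα0 : α ≠ 0 := by
        rintro rfl
        simp at hα
      obtain ⟨i, β, rfl, hβ⟩ := Finsupp.exists_single_add_of_ne_zero hα0
      rw [← hT i β (by omega), ih β (by omega) (by omega), map_sum]
      refine Finset.sum_congr rfl fun x _ => ?_
      rw [map_smul, hTu, smul_smul, monomialEval_add, monomialEval_single]
  have hinn : ∀ (a b : (σ → ℝ) → ℝ), inner ℝ (∑ x ∈ u.support, a x • u x)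
      (∑ x ∈ u.support, b x • u x) = ∑ x ∈ u.support, ‖u x‖ ^ 2 * (a x * b x) := by
    intro a b
    rw [sum_inner]
    refine Finset.sum_congr rfl fun x hx => ?_
    rw [inner_sum, Finset.sum_eq_single x]
    · rw [inner_smul_left, inner_smul_right, real_inner_self_eq_norm_sq]
      simp only [conj_trivial]
      ring
    · intro y _ hy
      rw [inner_smul_left, inner_smul_right, huu x y hy.symm]
      simp
    · exact fun h => absurd hx h
  have hpos : ∀ x ∈ u.support, 0 < ‖u x‖ ^ 2 := fun x hx => by
    have := norm_pos_iff.mpr (Finsupp.mem_support_iff.mp hx)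
    positivity
  refine ⟨u.support, fun x => ‖u x‖ ^ 2, hpos, ?_, ?_⟩
  · intro γ hγ
    obtain ⟨α, β, hα, hβ, rfl⟩ := Finsupp.exists_add_of_degree_le (k + 1) (k + 1) γ (by omega)
    rw [← hv α β hα hβ, hvα _ α rfl hα, hvα _ β rfl hβ, hinn]
    simp only [monomialEval_add]
  · intro x hx
    have hux : u x ∈ Submodule.span ℝ (Set.range fun α : ExponentsLE σ j => v α.1) := by
      have : (Set.range fun α : ExponentsLE σ j => v α.1) = v '' {α | α.degree ≤ j} := by
        ext y
        simp
      rw [this, hspan]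
      trivial
    -- The coefficients of `u x` in terms of the $v_\alpha$, $|\alpha|\le j$, are those of the
    -- interpolation polynomial. Pairing with `u y` reads off its value at `y`.
    obtain ⟨c, hc⟩ := (Submodule.mem_span_range_iff_exists_fun ℝ).mp hux
    have hc' : ∑ y ∈ u.support, (∑ α, c α * monomialEval y α.1) • u y = u x := by
      rw [← hc]
      simp only [Finset.sum_smul]
      rw [Finset.sum_comm]
      refine Finset.sum_congr rfl fun α _ => ?_
      rw [hvα _ α.1 rfl (by have := α.2; omega), Finset.smul_sum]
      simp only [smul_smul]
    have hux' : ∑ y ∈ u.support, (if y = x then (1 : ℝ) else 0) • u y = u x := by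
      simp only [ite_smul, one_smul, zero_smul, Finset.sum_ite_eq', hx, if_true]
    have key : ∀ y ∈ u.support, ∑ α, c α * monomialEval y α.1 = if y = x then 1 else 0 := by
      intro y hy
      have huy : ∑ y' ∈ u.support, (if y' = y then (1 : ℝ) else 0) • u y' = u y := by
        simp only [ite_smul, one_smul, zero_smul, Finset.sum_ite_eq', hy, if_true]
      have h := congrArg (fun a => inner ℝ a (u y)) (hc'.trans hux'.symm)
      rw [← huy, hinn, hinn] at h
      simp only [mul_ite, mul_one, mul_zero, Finset.sum_ite_eq', hy, if_true] at h
      have := hpos y hy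
      rcases eq_or_ne y x with rfl | hyx
      · simp only [if_true] at h ⊢
        exact mul_left_cancel₀ this.ne' (by linarith)
      · simp only [hyx, if_false] at h ⊢
        exact (mul_eq_zero.mp h).resolve_left this.ne'
    refine ⟨c, by simpa using key x hx, fun y hy hyx => by simpa [hyx] using key y hy⟩

end FlatExtension

/-! ### Atoms of a flat moment matrix and their localization -/

section FlatExtension

variable {σ : Type*} [Finite σ]

lemma Matrix.PosSemidef.exists_eq_conjTranspose_mul_self {ι 𝕜 : Type*} [Fintype ι] [RCLike 𝕜]
    {M : Matrix ι ι 𝕜} (hM : M.PosSemidef) : ∃ B : Matrix ι ι 𝕜, M = B.conjTranspose * B := by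
  classical
  open scoped MatrixOrder in
  exact CStarAlgebra.nonneg_iff_eq_star_mul_self.mp hM.nonneg

/-- A positive semidefinite flat moment matrix comes from a finite atomic measure, and there are
interpolation polynomials of low degree at its atoms. -/
theorem exists_atoms_of_flat {j k : ℕ} (hjk : j < k) {z : (σ →₀ ℕ) → ℝ}
    (hpsd : (momentMatrix k z).PosSemidef)
    (hrank : (momentMatrix k z).rank = (momentMatrix j z).rank) :
    ∃ (F : Finset (σ → ℝ)) (w : (σ → ℝ) → ℝ), (∀ x ∈ F, 0 < w x) ∧
      (∀ γ, γ.degree ≤ 2 * k → z γ = ∑ x ∈ F, w x * monomialEval x γ) ∧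
      ∀ x ∈ F, ∃ c : ExponentsLE σ j → ℝ, ∑ α, c α * monomialEval x α = 1 ∧
        ∀ y ∈ F, y ≠ x → ∑ α, c α * monomialEval y α = 0 := by
  classical
  obtain ⟨k, rfl⟩ : ∃ l, k = l + 1 := ⟨k - 1, by omega⟩
  obtain ⟨B, hB⟩ := hpsd.exists_eq_conjTranspose_mul_self
  let e : ExponentsLE σ j → ExponentsLE σ (k + 1) := fun α => ⟨α.1, by have := α.2; omega⟩
  have hBj : momentMatrix j z = (B.submatrix id e).conjTranspose * B.submatrix id e := by
    change (momentMatrix (k + 1) z).submatrix e e = _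
    rw [hB]
    rfl
  -- As $B^*B$ and $B$ have equal rank, equality of the ranks of the two moment matrices forces the
  -- low degree columns of $B$ to span all its columns.
  have hcol : Submodule.span ℝ (Set.range (B.submatrix id e).col) =
      Submodule.span ℝ (Set.range B.col) := by
    refine Submodule.eq_of_le_of_finrank_eq (Submodule.span_mono ?_) ?_
    · rintro _ ⟨α, rfl⟩
      exact ⟨e α, rfl⟩
    · rw [← Matrix.rank_eq_finrank_span_cols, ← Matrix.rank_eq_finrank_span_cols,
        ← Matrix.rank_conjTranspose_mul_self, ← Matrix.rank_conjTranspose_mul_self B, ← hB, ← hBj,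
        hrank]
  let L := (WithLp.linearEquiv 2 ℝ (ExponentsLE σ (k + 1) → ℝ)).symm.toLinearMap
  let v : (σ →₀ ℕ) → EuclideanSpace ℝ (ExponentsLE σ (k + 1)) := fun α =>
    if h : α.degree ≤ k + 1 then L (B.col ⟨α, h⟩) else 0
  have hvL : ∀ α (h : α.degree ≤ k + 1), v α = L (B.col ⟨α, h⟩) := fun α h => dif_pos h
  have hv : ∀ α β, α.degree ≤ k + 1 → β.degree ≤ k + 1 → inner ℝ (v α) (v β) = z (α + β) := by
    intro α β hα hβ
    have := congrFun (congrFun hB ⟨α, hα⟩) ⟨β, hβ⟩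
    simp only [momentMatrix, Matrix.of_apply] at this
    rw [this, hvL α hα, hvL β hβ, Matrix.mul_apply, PiLp.inner_apply]
    refine Finset.sum_congr rfl fun γ _ => ?_
    simp [L, Matrix.conjTranspose_apply, mul_comm]
  -- The columns need not fill the ambient space, so the Gram argument is run inside their span. The
  -- value $0$ of `v` above degree $k+1$ lies in it as well.
  let W : Submodule ℝ (EuclideanSpace ℝ (ExponentsLE σ (k + 1))) :=
    Submodule.span ℝ (v '' {α | α.degree ≤ j})
  have hW : W = (Submodule.span ℝ (Set.range (B.submatrix id e).col)).map L := by
    rw [Submodule.map_span, ← Set.range_comp]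
    refine congrArg (Submodule.span ℝ) (Set.ext fun x => ⟨?_, ?_⟩)
    · rintro ⟨α, hα, rfl⟩
      have hα' : α.degree ≤ j := hα
      exact ⟨⟨α, hα'⟩, (hvL α (by omega)).symm⟩
    · rintro ⟨α, rfl⟩
      exact ⟨α.1, α.2, hvL α.1 (e α).2⟩
  have hmem : ∀ α, v α ∈ W := by
    intro α
    by_cases h : α.degree ≤ k + 1
    · rw [hW, hcol, hvL α h]
      exact Submodule.mem_map_of_mem (Submodule.subset_span ⟨_, rfl⟩)
    · simp only [v, h, dif_neg, not_false_eq_true]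
      exact W.zero_mem
  have hspan : Submodule.span ℝ ((fun α => (⟨v α, hmem α⟩ : W)) '' {α | α.degree ≤ j}) = ⊤ := by
    apply Submodule.map_injective_of_injective W.injective_subtype
    rw [Submodule.map_span, Submodule.map_top, Submodule.range_subtype, ← Set.image_comp]
    rfl
  exact exists_atoms_of_gram (H := W) (v := fun α => ⟨v α, hmem α⟩) (by omega)
    (fun α β hα hβ => hv α β hα hβ) hspan

lemma totalDegree_le_two_mul_halfDegree {σ : Type*} (g : MvPolynomial σ ℝ) :
    g.totalDegree ≤ 2 * halfDegree g := by
  have := Nat.le_ceil ((g.totalDegree : ℚ) / 2)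
  rw [div_le_iff₀ two_pos] at this
  rw [mul_comm]
  exact_mod_cast this

/-- Integration of $g\,x^\alpha$ against the atoms: shifting by $g$ multiplies each weight by the
value of $g$. The degree bound ensures that only represented moments are read. -/
lemma shiftedSeq_eq_sum {σ ι : Type*} (g : MvPolynomial σ ℝ) (s : Finset ι) {w : ι → ℝ}
    {x : ι → σ → ℝ} {D : ℕ} {z : (σ →₀ ℕ) → ℝ}
    (hz : ∀ γ : σ →₀ ℕ, γ.degree ≤ D → z γ = ∑ j ∈ s, w j * monomialEval (x j) γ)
    (α : σ →₀ ℕ) (hα : α.degree + 2 * halfDegree g ≤ D) :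
    shiftedSeq g z α = ∑ j ∈ s, w j * MvPolynomial.eval (x j) g * monomialEval (x j) α := by
  have h1 : ∀ γ ∈ g.support, g.coeff γ * z (α + γ) =
      ∑ j ∈ s, w j * (g.coeff γ * monomialEval (x j) γ) * monomialEval (x j) α := by
    intro γ hγ
    have h2 : γ.degree ≤ g.totalDegree := MvPolynomial.le_totalDegree hγ
    have h3 := totalDegree_le_two_mul_halfDegree g
    rw [hz _ (by rw [map_add]; omega), Finset.mul_sum]
    refine Finset.sum_congr rfl fun y _ => ?_
    rw [monomialEval_add]
    ring
  rw [shiftedSeq, Finset.sum_congr rfl h1, Finset.sum_comm]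
  refine Finset.sum_congr rfl fun y _ => ?_
  rw [eval_eq_sum_monomialEval, Finset.mul_sum, Finset.sum_mul]

/-- The atoms of a flat truncated moment sequence lie in the set that is cut out by the
polynomials whose localizing matrices are positive semidefinite. -/
theorem exists_atoms_mem_of_flat {j k : ℕ} (hjk : j < k) {m : ℕ} (g : Fin m → MvPolynomial σ ℝ)
    (hg : ∀ i, j + halfDegree (g i) ≤ k) {z : (σ →₀ ℕ) → ℝ}
    (hpsd : (momentMatrix k z).PosSemidef)
    (hrank : (momentMatrix k z).rank = (momentMatrix j z).rank)
    (hloc : ∀ i, (momentMatrix (k - halfDegree (g i)) (shiftedSeq (g i) z)).PosSemidef) :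
    ∃ (F : Finset (σ → ℝ)) (w : (σ → ℝ) → ℝ), (∀ x ∈ F, 0 < w x) ∧
      (∀ γ, γ.degree ≤ 2 * k → z γ = ∑ x ∈ F, w x * monomialEval x γ) ∧
      ∀ x ∈ F, x ∈ basicClosedSet g := by
  classical
  obtain ⟨F, w, hw, hz, hF⟩ := exists_atoms_of_flat hjk hpsd hrank
  refine ⟨F, w, hw, hz, fun x hx i => ?_⟩
  obtain ⟨c, hcx, hcy⟩ := hF x hx
  have hshift : ∀ α : σ →₀ ℕ, α.degree ≤ 2 * j → shiftedSeq (g i) z α =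
      ∑ y ∈ F, w y * MvPolynomial.eval y (g i) * monomialEval y α := fun α hα =>
    shiftedSeq_eq_sum (x := fun y => y) (g i) F hz α (by have := hg i; omega)
  -- A principal submatrix of the localizing matrix, because $j\le k-d_{g_i}$.
  have hM : (momentMatrix j (shiftedSeq (g i) z)).PosSemidef :=
    (hloc i).submatrix fun α : ExponentsLE σ j =>
      (⟨α.1, by have := α.2; have := hg i; omega⟩ : ExponentsLE σ (k - halfDegree (g i)))
  have hnn := hM.dotProduct_mulVec_nonneg c
  have hval : star c ⬝ᵥ (momentMatrix j (shiftedSeq (g i) z)).mulVec c =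
      ∑ y ∈ F, w y * MvPolynomial.eval y (g i) * (∑ α, c α * monomialEval y α) ^ 2 := by
    simp only [dotProduct, Matrix.mulVec, momentMatrix, Matrix.of_apply, star_trivial]
    have h1 : ∀ α β : ExponentsLE σ j, shiftedSeq (g i) z (α.1 + β.1) =
        ∑ y ∈ F, w y * MvPolynomial.eval y (g i) * (monomialEval y α * monomialEval y β) := by
      intro α β
      rw [hshift _ (by rw [map_add]; have := α.2; have := β.2; omega)]
      simp only [monomialEval_add]
    simp only [h1, Finset.mul_sum, Finset.sum_mul, pow_two]
    rw [Finset.sum_congr rfl fun a _ => Finset.sum_comm, Finset.sum_comm]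
    refine Finset.sum_congr rfl fun y _ => ?_
    rw [Finset.sum_comm]
    refine Finset.sum_congr rfl fun a _ => Finset.sum_congr rfl fun b _ => ?_
    ring
  -- The interpolation polynomial vanishes at all other atoms, leaving $w_x\,g_i(x)\ge0$.
  rw [hval, Finset.sum_eq_single x] at hnn
  · rw [hcx] at hnn
    simp only [one_pow, mul_one] at hnn
    exact nonneg_of_mul_nonneg_right hnn (hw x hx)
  · intro y hy hyx
    rw [hcy y hy hyx]
    ring
  · exact fun h => absurd hx h

end FlatExtension

/-! ### Flat extensions from finite atomic measures -/

section FlatExtension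

variable {σ : Type*}

lemma momentMatrix_congr {z z' : (σ →₀ ℕ) → ℝ} {k : ℕ}
    (h : ∀ α : σ →₀ ℕ, α.degree ≤ 2 * k → z α = z' α) : momentMatrix k z = momentMatrix k z' := by
  ext α β
  exact h _ (by rw [map_add]; have := α.2; have := β.2; omega)

lemma momentMatrix_atomic {r : ℕ} (w : Fin r → ℝ) (x : Fin r → σ → ℝ) (k : ℕ) :
    momentMatrix k (fun α => ∑ j, w j * monomialEval (x j) α) =
      ∑ j, w j • Matrix.vecMulVec (fun α : ExponentsLE σ k => monomialEval (x j) α.1)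
        (star fun α : ExponentsLE σ k => monomialEval (x j) α.1) := by
  ext α β
  rw [Matrix.sum_apply]
  simp [momentMatrix, Matrix.vecMulVec_apply, monomialEval_add]

lemma halfDegree_le_flatOrder {m : ℕ} (g : Fin m → MvPolynomial σ ℝ) (i : Fin m) :
    halfDegree (g i) ≤ flatOrder g :=
  le_max_of_le_right (Finset.le_sup (f := fun i => halfDegree (g i)) (Finset.mem_univ i))

lemma one_le_flatOrder {m : ℕ} (g : Fin m → MvPolynomial σ ℝ) : 1 ≤ flatOrder g :=
  le_max_left _ _

variable [Finite σ]

lemma momentMatrix_rank_mono (z : (σ →₀ ℕ) → ℝ) : Monotone fun k => (momentMatrix k z).rank := by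
  intro j k h
  let e : ExponentsLE σ j → ExponentsLE σ k := fun α => ⟨α.1, α.2.trans h⟩
  exact Matrix.rank_submatrix_le (momentMatrix k z) e e

lemma momentMatrix_atomic_posSemidef {r : ℕ} {w : Fin r → ℝ} (hw : ∀ j, 0 ≤ w j)
    (x : Fin r → σ → ℝ) (k : ℕ) :
    (momentMatrix k (fun α => ∑ j, w j * monomialEval (x j) α)).PosSemidef := by
  rw [momentMatrix_atomic]
  exact Matrix.posSemidef_sum _ fun j _ => (Matrix.posSemidef_vecMulVec_self_star _).smul (hw j)

/-- The matrix factors through $\mathbb R^r$; the bound does not depend on $k$. -/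
lemma momentMatrix_atomic_rank_le {r : ℕ} (w : Fin r → ℝ) (x : Fin r → σ → ℝ) (k : ℕ) :
    (momentMatrix k (fun α => ∑ j, w j * monomialEval (x j) α)).rank ≤ r := by
  have h : momentMatrix k (fun α => ∑ j, w j * monomialEval (x j) α) =
      (Matrix.of fun (α : ExponentsLE σ k) j => w j * monomialEval (x j) α.1) *
        Matrix.of fun j (α : ExponentsLE σ k) => monomialEval (x j) α.1 := by
    ext α β
    simp [momentMatrix, Matrix.mul_apply, monomialEval_add, mul_assoc]
  rw [h]
  exact (Matrix.rank_mul_le_left _ _).trans ((Matrix.rank_le_card_width _).trans (by simp))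

/-- The truncated moment sequences of a finite atomic measure on `{g_1 ≥ 0, …, g_m ≥ 0}` are
eventually flat and have positive semidefinite moment and localizing matrices. -/
theorem exists_flat_of_atoms {m : ℕ} (g : Fin m → MvPolynomial σ ℝ) {r : ℕ} {w : Fin r → ℝ}
    {x : Fin r → σ → ℝ} (hw : ∀ j, 0 ≤ w j) (hx : ∀ j, x j ∈ basicClosedSet g) (d : ℕ) :
    ∃ (k : ℕ) (z : TruncSeqLE σ (2 * k)), d < 2 * k ∧ flatOrder g ≤ k ∧
      (∀ α : σ →₀ ℕ, α.degree ≤ 2 * k → z.val α = ∑ j, w j * monomialEval (x j) α) ∧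
      (momentMatrix k z.val).rank = (momentMatrix (k - flatOrder g) z.val).rank ∧
      (momentMatrix k z.val).PosSemidef ∧
      ∀ i, (momentMatrix (k - halfDegree (g i)) (shiftedSeq (g i) z.val)).PosSemidef := by
  let ζ : (σ →₀ ℕ) → ℝ := fun α => ∑ j, w j * monomialEval (x j) α
  have hbdd : BddAbove (Set.range fun k => (momentMatrix k ζ).rank) :=
    ⟨r, by rintro _ ⟨k, rfl⟩; exact momentMatrix_atomic_rank_le w x k⟩
  obtain ⟨j₀, hj₀⟩ := Nat.sSup_mem (Set.range_nonempty _) hbdd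
  have hstab : ∀ k, j₀ ≤ k → (momentMatrix k ζ).rank = (momentMatrix j₀ ζ).rank := fun k hk =>
    le_antisymm ((le_csSup hbdd ⟨k, rfl⟩).trans hj₀.ge) (momentMatrix_rank_mono ζ hk)
  -- Large enough that $k-d_0\ge j_0$, where the rank is already maximal, and that $2k>d$.
  let k := j₀ + flatOrder g + d + 1
  let z : TruncSeqLE σ (2 * k) := fun β => ζ β.1
  have hz : ∀ α : σ →₀ ℕ, α.degree ≤ 2 * k → z.val α = ζ α := fun α hα => dif_pos hα
  have hM : ∀ l ≤ k, momentMatrix l z.val = momentMatrix l ζ := fun l hl =>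
    momentMatrix_congr fun α hα => hz α (by omega)
  refine ⟨k, z, by omega, by omega, hz, ?_, ?_, fun i => ?_⟩
  · rw [hM _ le_rfl, hM _ (Nat.sub_le _ _), hstab k (by omega), hstab (k - flatOrder g) (by omega)]
  · rw [hM _ le_rfl]
    exact momentMatrix_atomic_posSemidef hw x k
  · have hi := halfDegree_le_flatOrder g i
    rw [momentMatrix_congr fun α hα => shiftedSeq_eq_sum (g i) Finset.univ hz α (by omega)]
    exact momentMatrix_atomic_posSemidef (fun j => mul_nonneg (hw j) (hx j i)) x _

end FlatExtension

/-! ### Product operator bases -/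

section TensorMatrix

variable {d : ℕ} {n t : Fin d → ℕ}

lemma tensorMatrix_mul (A B : ∀ i, Matrix (Fin (n i)) (Fin (n i)) ℂ) :
    tensorMatrix A * tensorMatrix B = tensorMatrix fun i => A i * B i := by
  ext p q
  simp only [tensorMatrix, Matrix.mul_apply, Matrix.of_apply, Finset.prod_univ_sum,
    Fintype.piFinset_univ, Finset.prod_mul_distrib]

lemma tensorMatrix_trace (A : ∀ i, Matrix (Fin (n i)) (Fin (n i)) ℂ) :
    (tensorMatrix A).trace = ∏ i, (A i).trace := by
  simp only [tensorMatrix, Matrix.trace, Matrix.diag_apply, Matrix.of_apply, Finset.prod_univ_sum,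
    Fintype.piFinset_univ]

lemma tensorMatrix_conjTranspose (A : ∀ i, Matrix (Fin (n i)) (Fin (n i)) ℂ) :
    (tensorMatrix A).conjTranspose = tensorMatrix fun i => (A i).conjTranspose := by
  ext p q
  simp [tensorMatrix, Matrix.conjTranspose_apply]

lemma tensorMatrix_smul (c : Fin d → ℂ) (A : ∀ i, Matrix (Fin (n i)) (Fin (n i)) ℂ) :
    tensorMatrix (fun i => c i • A i) = (∏ i, c i) • tensorMatrix A := by
  ext p q
  simp [tensorMatrix, Finset.prod_mul_distrib]

lemma tensorMatrix_sum_smul (c : ∀ i, Fin (t i + 1) → ℂ)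
    (S : ∀ i, Fin (t i + 1) → Matrix (Fin (n i)) (Fin (n i)) ℂ) :
    tensorMatrix (fun i => ∑ a, c i a • S i a) =
      ∑ μ : ∀ i, Fin (t i + 1), (∏ i, c i (μ i)) • tensorMatrix fun i => S i (μ i) := by
  ext p q
  simp only [tensorMatrix, Matrix.of_apply, Matrix.sum_apply, Matrix.smul_apply, smul_eq_mul,
    Finset.prod_univ_sum, Fintype.piFinset_univ, Finset.prod_mul_distrib]

lemma tensorMatrix_single (p q : ∀ i, Fin (n i)) :
    (tensorMatrix fun i => Matrix.single (p i) (q i) (1 : ℂ)) = Matrix.single p q 1 := by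
  ext p' q'
  simp only [tensorMatrix, Matrix.of_apply, Matrix.single_apply, Finset.prod_ite_zero,
    Finset.prod_const_one, Finset.mem_univ, forall_true_left, forall_and, funext_iff]

end TensorMatrix

/-- Hermitian matrices have real coordinates in a Hermitian basis. -/
lemma exists_real_coords_of_isHermitian {ι κ : Type*} [Fintype ι] [Fintype κ]
    {T : κ → Matrix ι ι ℂ} (hT : ∀ μ, (T μ).IsHermitian) (hli : LinearIndependent ℂ T)
    (hspan : Submodule.span ℂ (Set.range T) = ⊤) {A : Matrix ι ι ℂ} (hA : A.IsHermitian) :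
    ∃ a : κ → ℝ, A = ∑ μ, (a μ : ℂ) • T μ := by
  obtain ⟨c, hc⟩ := (Submodule.mem_span_range_iff_exists_fun ℂ).mp
    (hspan ▸ Submodule.mem_top : A ∈ Submodule.span ℂ (Set.range T))
  have hsum : ∑ μ, star (c μ) • T μ = ∑ μ, c μ • T μ := by
    rw [hc]
    conv_rhs => rw [← hA.eq, ← hc, Matrix.conjTranspose_sum]
    simp only [Matrix.conjTranspose_smul, (hT _).eq]
  have h0 : ∀ μ, star (c μ) - c μ = 0 := by
    refine Fintype.linearIndependent_iff.mp hli _ ?_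
    simp only [sub_smul, Finset.sum_sub_distrib, hsum, sub_self]
  refine ⟨fun μ => (c μ).re, ?_⟩
  rw [← hc]
  refine Finset.sum_congr rfl fun μ _ => ?_
  congr 1
  exact (Complex.conj_eq_iff_re.mp (sub_eq_zero.mp (h0 μ))).symm

/-! ### Dimension and traces of a local basis -/

namespace IsHermitianOperatorBasis

variable {N t : ℕ} {S : Fin (t + 1) → Matrix (Fin N) (Fin N) ℂ}

/-- The dimension count $t+1=N^2$ turns the factor $1/\sqrt{t+1}$ into $1/N$, the trace
normalization of a local state. -/
lemma card_eq (hS : IsHermitianOperatorBasis S) : t + 1 = N * N := by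
  have := Module.finrank_eq_card_basis (Module.Basis.mk hS.linearIndependent hS.span_eq_top.ge)
  simpa [Module.finrank_matrix] using this.symm

lemma sqrt_eq (hS : IsHermitianOperatorBasis S) : Real.sqrt ((t : ℝ) + 1) = N := by
  have h : ((t : ℝ) + 1) = N * N := by exact_mod_cast hS.card_eq
  rw [h, Real.sqrt_mul_self (Nat.cast_nonneg N)]

lemma size_pos (hS : IsHermitianOperatorBasis S) : 0 < N := by
  have := hS.card_eq
  rcases Nat.eq_zero_or_pos N with rfl | h
  · simp at this
  · exact h

lemma trace_mul_eq_zero (hS : IsHermitianOperatorBasis S) {μ ν : Fin (t + 1)} (h : μ ≠ ν) :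
    (S μ * S ν).trace = 0 := by
  have := hS.orthogonal μ ν h
  rwa [(hS.isHermitian μ).eq] at this

lemma trace_mul_self_ne_zero (hS : IsHermitianOperatorBasis S) (μ : Fin (t + 1)) :
    (S μ * S μ).trace ≠ 0 := by
  intro h
  nth_rw 1 [← (hS.isHermitian μ).eq] at h
  exact hS.linearIndependent.ne_zero μ (Matrix.trace_conjTranspose_mul_self_eq_zero_iff.mp h)

lemma trace_zero (hS : IsHermitianOperatorBasis S) : (S 0).trace = N := by
  simp [hS.zero_eq_one]

lemma trace_succ (hS : IsHermitianOperatorBasis S) (a : Fin t) : (S a.succ).trace = 0 := by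
  have := hS.trace_mul_eq_zero (Fin.succ_ne_zero a).symm
  rwa [hS.zero_eq_one, one_mul] at this

lemma trace_sum (hS : IsHermitianOperatorBasis S) (c : Fin (t + 1) → ℂ) :
    (∑ μ, c μ • S μ).trace = c 0 * N := by
  rw [Matrix.trace_sum, Fin.sum_univ_succ]
  simp [hS.trace_zero, hS.trace_succ]

end IsHermitianOperatorBasis

/-! ### The product basis and coordinates -/

section ProductBasis

variable {d : ℕ} {n t : Fin d → ℕ} {S : ∀ i, Fin (t i + 1) → Matrix (Fin (n i)) (Fin (n i)) ℂ}

lemma tensorMatrix_basis_isHermitian (hS : ∀ i, IsHermitianOperatorBasis (S i))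
    (μ : ∀ i, Fin (t i + 1)) : (tensorMatrix fun i => S i (μ i)).IsHermitian := by
  rw [Matrix.IsHermitian, tensorMatrix_conjTranspose]
  simp only [((hS _).isHermitian _).eq]

/-- Traces of tensor products factor, so the trace pairing with one basis tensor kills all the
others. -/
lemma tensorMatrix_basis_linearIndependent (hS : ∀ i, IsHermitianOperatorBasis (S i)) :
    LinearIndependent ℂ fun μ : ∀ i, Fin (t i + 1) => tensorMatrix fun i => S i (μ i) := by
  classical
  rw [Fintype.linearIndependent_iff]
  intro c hc ν
  have h := congrArg (fun A => (A * tensorMatrix fun i => S i (ν i)).trace) hc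
  simp only [Finset.sum_mul, Matrix.trace_sum, Matrix.smul_mul, Matrix.trace_smul,
    tensorMatrix_mul, tensorMatrix_trace, zero_mul, Matrix.trace_zero] at h
  rw [Finset.sum_eq_single ν] at h
  · refine (mul_eq_zero.mp h).resolve_right (Finset.prod_ne_zero_iff.mpr fun i _ => ?_)
    exact (hS i).trace_mul_self_ne_zero _
  · intro μ _ hμ
    obtain ⟨i, hi⟩ := Function.ne_iff.mp hμ
    rw [Finset.prod_eq_zero (Finset.mem_univ i) ((hS i).trace_mul_eq_zero hi), smul_zero]
  · exact fun h => absurd (Finset.mem_univ _) h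

/-- Matrix units of the full space are tensor products of local matrix units, which expand in the
local bases. -/
lemma tensorMatrix_basis_span (hS : ∀ i, IsHermitianOperatorBasis (S i)) :
    Submodule.span ℂ (Set.range fun μ : ∀ i, Fin (t i + 1) => tensorMatrix fun i => S i (μ i)) =
      ⊤ := by
  classical
  rw [eq_top_iff]
  rintro A -
  rw [Matrix.matrix_eq_sum_single A]
  refine Submodule.sum_mem _ fun p _ => Submodule.sum_mem _ fun q _ => ?_
  have hex : ∀ i, ∃ c : Fin (t i + 1) → ℂ,
      ∑ a, c a • S i a = Matrix.single (p i) (q i) (1 : ℂ) := fun i =>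
    (Submodule.mem_span_range_iff_exists_fun ℂ).mp ((hS i).span_eq_top ▸ Submodule.mem_top)
  choose c hc using hex
  have h1 : Matrix.single p q (A p q) = A p q • Matrix.single p q (1 : ℂ) := by simp
  rw [h1, ← tensorMatrix_single, ← funext hc, tensorMatrix_sum_smul]
  exact Submodule.smul_mem _ _ (Submodule.sum_mem _ fun μ _ =>
    Submodule.smul_mem _ _ (Submodule.subset_span ⟨μ, rfl⟩))

lemma normalization_eq (hS : ∀ i, IsHermitianOperatorBasis (S i)) :
    ((∏ i, 1 / Real.sqrt ((t i : ℝ) + 1) : ℝ) : ℂ) = ∏ i, (n i : ℂ)⁻¹ := by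
  push_cast
  refine Finset.prod_congr rfl fun i _ => ?_
  have := (hS i).sqrt_eq
  rw [this]
  simp

lemma prod_size_inv_ne_zero (hS : ∀ i, IsHermitianOperatorBasis (S i)) :
    ∏ i, (n i : ℂ)⁻¹ ≠ 0 :=
  Finset.prod_ne_zero_iff.mpr fun i _ =>
    inv_ne_zero (Nat.cast_ne_zero.mpr (hS i).size_pos.ne')

lemma operatorOfCoords_injective (hS : ∀ i, IsHermitianOperatorBasis (S i)) :
    Function.Injective (operatorOfCoords S) := by
  intro X Y h
  rw [operatorOfCoords, operatorOfCoords, normalization_eq hS] at h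
  have h' := smul_right_injective _ (prod_size_inv_ne_zero hS) h
  have h0 : ∀ μ, ((X μ : ℂ) - Y μ) = 0 := by
    refine Fintype.linearIndependent_iff.mp (tensorMatrix_basis_linearIndependent hS) _ ?_
    simp only [sub_smul, Finset.sum_sub_distrib]
    exact sub_eq_zero.mpr h'
  funext μ
  exact_mod_cast sub_eq_zero.mp (h0 μ)

lemma exists_operatorOfCoords_eq (hS : ∀ i, IsHermitianOperatorBasis (S i))
    {ρ : Matrix (∀ i, Fin (n i)) (∀ i, Fin (n i)) ℂ} (hρ : ρ.IsHermitian) :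
    ∃ X, ρ = operatorOfCoords S X := by
  obtain ⟨a, ha⟩ := exists_real_coords_of_isHermitian (tensorMatrix_basis_isHermitian hS)
    (tensorMatrix_basis_linearIndependent hS) (tensorMatrix_basis_span hS) hρ
  refine ⟨fun μ => (∏ i, (n i : ℝ)) * a μ, ?_⟩
  rw [operatorOfCoords, normalization_eq hS, ha, Finset.smul_sum]
  refine Finset.sum_congr rfl fun μ _ => ?_
  rw [smul_smul]
  congr 1
  have := prod_size_inv_ne_zero hS
  rw [Finset.prod_inv_distrib] at this ⊢
  push_cast
  rw [← mul_assoc, inv_mul_cancel₀ fun h => this (by rw [h, inv_zero]), one_mul]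

/-- The operator with product coordinates is the tensor product of the local operators. -/
lemma operatorOfCoords_prod (hS : ∀ i, IsHermitianOperatorBasis (S i))
    (x : ∀ i, Fin (t i + 1) → ℝ) :
    operatorOfCoords S (fun μ => ∏ i, x i (μ i)) =
      tensorMatrix fun i => (n i : ℂ)⁻¹ • ∑ a, (x i a : ℂ) • S i a := by
  rw [operatorOfCoords, normalization_eq hS, tensorMatrix_smul, tensorMatrix_sum_smul]
  simp only [Complex.ofReal_prod]

lemma operatorOfCoords_sum {r : ℕ} (w : Fin r → ℝ) (X : Fin r → (∀ i, Fin (t i + 1)) → ℝ) :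
    operatorOfCoords S (fun μ => ∑ j, w j * X j μ) =
      ∑ j, (w j : ℂ) • operatorOfCoords S (X j) := by
  simp only [operatorOfCoords, Complex.ofReal_sum, Complex.ofReal_mul, Finset.sum_smul,
    Finset.smul_sum, smul_smul]
  rw [Finset.sum_comm]
  refine Finset.sum_congr rfl fun j _ => Finset.sum_congr rfl fun μ _ => ?_
  congr 1
  ring

end ProductBasis

/-! ### The set `K` -/

/-- With $M=B^*B$, an entry is an inner product of two columns of $B$. The inequality $2ab\le
a^2+b^2$ bounds it by the mean of two diagonal entries. -/
lemma Matrix.PosSemidef.norm_apply_le_trace {ι : Type*} [Fintype ι] {M : Matrix ι ι ℂ}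
    (hM : M.PosSemidef) (p q : ι) : ‖M p q‖ ≤ M.trace.re := by
  have htr : ∀ p, (M p p).re ≤ M.trace.re := by
    intro p
    rw [Matrix.trace, Complex.re_sum]
    exact Finset.single_le_sum (f := fun i => (M i i).re)
      (fun i _ => (Complex.nonneg_iff.mp hM.diag_nonneg).1) (Finset.mem_univ p)
  obtain ⟨B, hB⟩ := hM.exists_eq_conjTranspose_mul_self
  have hdiag : ∀ p, (M p p).re = ∑ r, ‖B r p‖ ^ 2 := by
    intro p
    rw [hB, Matrix.mul_apply, Complex.re_sum]
    refine Finset.sum_congr rfl fun r _ => ?_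
    rw [Matrix.conjTranspose_apply, Complex.star_def, ← Complex.normSq_eq_conj_mul_self,
      Complex.ofReal_re, Complex.normSq_eq_norm_sq]
  have h1 : ‖M p q‖ ≤ ∑ r, ‖B r p‖ * ‖B r q‖ := by
    rw [hB, Matrix.mul_apply]
    refine (norm_sum_le _ _).trans_eq (Finset.sum_congr rfl fun r _ => ?_)
    rw [norm_mul, Matrix.conjTranspose_apply, norm_star]
  have h2 : 2 * ∑ r, ‖B r p‖ * ‖B r q‖ ≤ ∑ r, ‖B r p‖ ^ 2 + ∑ r, ‖B r q‖ ^ 2 := by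
    rw [Finset.mul_sum, ← Finset.sum_add_distrib]
    exact Finset.sum_le_sum fun r _ => by rw [← mul_assoc]; exact two_mul_le_add_sq _ _
  rw [← hdiag, ← hdiag] at h2
  linarith [htr p, htr q]

namespace IsHermitianOperatorBasis

variable {N t : ℕ} {S : Fin (t + 1) → Matrix (Fin N) (Fin N) ℂ}

lemma isHermitian_sum (hS : IsHermitianOperatorBasis S) (y : Fin t → ℝ) :
    (S 0 + ∑ a : Fin t, (y a : ℂ) • S a.succ).IsHermitian := by
  rw [Matrix.IsHermitian, Matrix.conjTranspose_add, Matrix.conjTranspose_sum,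
    (hS.isHermitian 0).eq]
  simp only [Matrix.conjTranspose_smul, (hS.isHermitian _).eq, Complex.star_def,
    Complex.conj_ofReal]

lemma trace_local (hS : IsHermitianOperatorBasis S) (y : Fin t → ℝ) :
    (S 0 + ∑ a : Fin t, (y a : ℂ) • S a.succ).trace = N := by
  simp [Matrix.trace_add, Matrix.trace_sum, hS.trace_zero, hS.trace_succ]

lemma isClosed_localStateSet (hS : IsHermitianOperatorBasis S) : IsClosed (localStateSet S) := by
  have h : localStateSet S = ⋂ v : Fin N → ℂ,
      {y | 0 ≤ star v ⬝ᵥ (S 0 + ∑ a : Fin t, (y a : ℂ) • S a.succ).mulVec v} := by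
    ext y
    simp only [localStateSet, Set.mem_ofPred_eq, Set.mem_iInter,
      Matrix.posSemidef_iff_dotProduct_mulVec, hS.isHermitian_sum y, true_and]
  rw [h]
  refine isClosed_iInter fun v => isClosed_le continuous_const ?_
  simp only [dotProduct, Matrix.mulVec, Matrix.add_apply, Matrix.sum_apply, Matrix.smul_apply,
    smul_eq_mul]
  fun_prop

/-- By orthogonality $y_a$ is $\operatorname{tr}(MS_a)/\operatorname{tr}(S_a^2)$ with $M=S_0+\sum_b
y_bS_b$. The entries of $M\ge0$ are bounded by its trace, which is always $N$. -/
lemma exists_bound_localStateSet (hS : IsHermitianOperatorBasis S) (a : Fin t) :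
    ∃ C : ℝ, ∀ y ∈ localStateSet S, |y a| ≤ C := by
  refine ⟨(∑ p, ∑ q, (N : ℝ) * ‖S a.succ q p‖) / ‖(S a.succ * S a.succ).trace‖, fun y hy => ?_⟩
  rw [le_div_iff₀ (norm_pos_iff.mpr (hS.trace_mul_self_ne_zero _))]
  have hy' : (S 0 + ∑ a : Fin t, (y a : ℂ) • S a.succ).PosSemidef := hy
  have htr : ((S 0 + ∑ a : Fin t, (y a : ℂ) • S a.succ) * S a.succ).trace =
      y a * (S a.succ * S a.succ).trace := by
    rw [add_mul, Matrix.trace_add, hS.trace_mul_eq_zero (Fin.succ_ne_zero a).symm, zero_add,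
      Finset.sum_mul, Matrix.trace_sum, Finset.sum_eq_single a]
    · rw [Matrix.smul_mul, Matrix.trace_smul, smul_eq_mul]
    · intro b _ hb
      rw [Matrix.smul_mul, Matrix.trace_smul,
        hS.trace_mul_eq_zero fun h => hb (Fin.succ_injective _ h), smul_zero]
    · exact fun h => absurd (Finset.mem_univ _) h
  have hnorm : |y a| * ‖(S a.succ * S a.succ).trace‖ =
      ‖((S 0 + ∑ a : Fin t, (y a : ℂ) • S a.succ) * S a.succ).trace‖ := by
    rw [htr, norm_mul, Complex.norm_real, Real.norm_eq_abs]
  rw [hnorm, Matrix.trace]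
  refine (norm_sum_le _ _).trans (Finset.sum_le_sum fun p _ => ?_)
  rw [Matrix.diag_apply, Matrix.mul_apply]
  refine (norm_sum_le _ _).trans (Finset.sum_le_sum fun q _ => ?_)
  rw [norm_mul]
  refine mul_le_mul_of_nonneg_right ?_ (norm_nonneg _)
  have := hy'.norm_apply_le_trace p q
  rwa [hS.trace_local, Complex.natCast_re] at this

end IsHermitianOperatorBasis

section ProductStateSet

variable {d : ℕ} {n t : Fin d → ℕ} {S : ∀ i, Fin (t i + 1) → Matrix (Fin (n i)) (Fin (n i)) ℂ}

theorem isCompact_productStateSet (hS : ∀ i, IsHermitianOperatorBasis (S i)) :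
    IsCompact (productStateSet S) := by
  choose C hC using fun i => (hS i).exists_bound_localStateSet
  refine (isCompact_univ_pi fun p : Σ i, Fin (t i) =>
    isCompact_Icc (a := -C p.1 p.2) (b := C p.1 p.2)).of_isClosed_subset ?_ ?_
  · have h : productStateSet S = ⋂ i, (fun (x : (Σ i : Fin d, Fin (t i)) → ℝ) (a : Fin (t i)) =>
        x ⟨i, a⟩) ⁻¹' localStateSet (S i) := by
      ext x
      simp [productStateSet]
    rw [h]
    exact isClosed_iInter fun i => (hS i).isClosed_localStateSet.preimage (by fun_prop)
  · intro x hx p _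
    exact abs_le.mp (hC p.1 p.2 _ (hx p.1))

end ProductStateSet

/-! ### Polynomial inequalities describing $K$ -/

section Semialgebraic

/-- A Hermitian matrix `A` is positive semidefinite iff the polynomial `det (X + A)` has
nonnegative coefficients. -/
lemma Matrix.IsHermitian.posSemidef_iff_charpoly_neg_coeff {ι : Type*} [Fintype ι] [DecidableEq ι]
    {A : Matrix ι ι ℂ} (hA : A.IsHermitian) :
    A.PosSemidef ↔ ∀ k, 0 ≤ ((-A).charpoly.coeff k).re := by
  constructor
  · intro h
    have hB : (-A).IsHermitian := hA.neg
    have hnonpos : ∀ i, hB.eigenvalues i ≤ 0 := by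
      intro i
      rw [hB.eigenvalues_eq, Matrix.neg_mulVec, dotProduct_neg, map_neg, neg_nonpos]
      exact h.re_dotProduct_nonneg _
    -- Each factor $X-\lambda$ with $\lambda\le0$ has nonnegative coefficients, and products
    -- preserve this.
    have key : ∀ s : Finset ι, ∀ k,
        0 ≤ (∏ i ∈ s, (Polynomial.X - Polynomial.C (hB.eigenvalues i : ℂ))).coeff k := by
      classical
      intro s
      induction s using Finset.induction_on with
      | empty =>
        intro k
        rw [Finset.prod_empty, Polynomial.coeff_one]
        split_ifs <;> simp
      | insert i s hi ih =>
        intro k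
        rw [Finset.prod_insert hi, Polynomial.coeff_mul]
        refine Finset.sum_nonneg fun p _ => mul_nonneg ?_ (ih _)
        rw [Polynomial.coeff_sub, Polynomial.coeff_X, Polynomial.coeff_C]
        have := hnonpos i
        have h' : (0 : ℂ) ≤ -(hB.eigenvalues i : ℂ) := by
          rw [← Complex.ofReal_neg]
          exact Complex.zero_le_real.mpr (by linarith)
        split_ifs with h1 h2 h2
        · omega
        · simp
        · simpa using h'
        · simp
    intro k
    rw [hB.charpoly_eq]
    exact (Complex.nonneg_iff.mp (key _ k)).1
  · intro h
    rw [hA.posSemidef_iff_eigenvalues_nonneg]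
    intro i
    by_contra hneg
    rw [Pi.zero_apply, not_le] at hneg
    -- A negative eigenvalue $\lambda$ of $A$ makes $-\lambda>0$ a root of a monic polynomial with
    -- coefficients of nonnegative real part. Every term of its value, including the leading one,
    -- would then have real part zero.
    have h1 : (-A).charpoly.eval ((-hA.eigenvalues i : ℝ) : ℂ) = 0 := by
      have h0 : A.charpoly.eval (hA.eigenvalues i : ℂ) = 0 := by
        rw [hA.charpoly_eq, Polynomial.eval_prod]
        exact Finset.prod_eq_zero (Finset.mem_univ i) (by simp)
      rw [Matrix.eval_charpoly] at h0 ⊢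
      have h2 : Matrix.scalar ι ((-hA.eigenvalues i : ℝ) : ℂ) - -A =
          -(Matrix.scalar ι (hA.eigenvalues i : ℂ) - A) := by
        rw [Complex.ofReal_neg, map_neg]
        abel
      rw [h2, Matrix.det_neg, h0, mul_zero]
    rw [Polynomial.eval_eq_sum_range, (-A).charpoly_natDegree_eq_dim] at h1
    have h3 := congrArg Complex.re h1
    rw [Complex.re_sum, Complex.zero_re] at h3
    have hterm : ∀ k, ((-A).charpoly.coeff k * ((-hA.eigenvalues i : ℝ) : ℂ) ^ k).re =
        ((-A).charpoly.coeff k).re * (-hA.eigenvalues i) ^ k := by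
      intro k
      rw [← Complex.ofReal_pow, Complex.re_mul_ofReal]
    simp only [hterm] at h3
    have h4 := (Finset.sum_eq_zero_iff_of_nonneg fun k _ =>
      mul_nonneg (h k) (pow_nonneg (by linarith) k)).mp h3 (Fintype.card ι) (by simp)
    have h5 : (-A).charpoly.coeff (Fintype.card ι) = 1 := by
      rw [← (-A).charpoly_natDegree_eq_dim]
      exact (-A).charpoly_monic
    rw [h5, Complex.one_re, one_mul] at h4
    exact absurd h4 (pow_pos (by linarith) _).ne'

/-- The real part of a complex polynomial is a real polynomial on real points. -/
lemma MvPolynomial.exists_eval_eq_re {σ : Type*} (p : MvPolynomial σ ℂ) :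
    ∃ q : MvPolynomial σ ℝ, ∀ x : σ → ℝ, eval x q = (eval (fun i => (x i : ℂ)) p).re := by
  suffices h : ∃ q r : MvPolynomial σ ℝ, ∀ x : σ → ℝ,
      eval (fun i => (x i : ℂ)) p = (eval x q : ℂ) + (eval x r : ℂ) * Complex.I by
    obtain ⟨q, r, h⟩ := h
    exact ⟨q, fun x => by simp [h x]⟩
  induction p using MvPolynomial.induction_on with
  | C a => exact ⟨C a.re, C a.im, fun x => by simp [Complex.re_add_im]⟩
  | add p₁ p₂ h₁ h₂ =>
    obtain ⟨q₁, r₁, h₁⟩ := h₁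
    obtain ⟨q₂, r₂, h₂⟩ := h₂
    refine ⟨q₁ + q₂, r₁ + r₂, fun x => ?_⟩
    simp only [map_add, h₁, h₂, Complex.ofReal_add]
    ring
  | mul_X p i h =>
    obtain ⟨q, r, h⟩ := h
    refine ⟨q * X i, r * X i, fun x => ?_⟩
    simp only [map_mul, eval_X, h, Complex.ofReal_mul]
    ring

variable {d : ℕ} {n t : Fin d → ℕ} {S : ∀ i, Fin (t i + 1) → Matrix (Fin (n i)) (Fin (n i)) ℂ}

theorem exists_basicClosedSet_eq_productStateSet (hS : ∀ i, IsHermitianOperatorBasis (S i)) :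
    ∃ (m : ℕ) (g : Fin m → MvPolynomial (Σ i : Fin d, Fin (t i)) ℝ),
      productStateSet S = basicClosedSet g := by
  classical
  let M : ∀ i, Matrix (Fin (n i)) (Fin (n i)) (MvPolynomial (Σ i : Fin d, Fin (t i)) ℂ) := fun i =>
    -((S i 0).map (MvPolynomial.C (R := ℂ)) +
      ∑ a : Fin (t i), MvPolynomial.X (R := ℂ) (⟨i, a⟩ : Σ i : Fin d, Fin (t i)) •
        (S i a.succ).map (MvPolynomial.C (R := ℂ)))
  have hM : ∀ i (x : (Σ i : Fin d, Fin (t i)) → ℝ),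
      (M i).map (MvPolynomial.eval fun p => (x p : ℂ)) =
        -(S i 0 + ∑ a : Fin (t i), (x ⟨i, a⟩ : ℂ) • S i a.succ) := by
    intro i x
    ext p q
    simp [M, Matrix.sum_apply]
  choose q hq using fun (i : Fin d) (k : ℕ) =>
    MvPolynomial.exists_eval_eq_re ((M i).charpoly.coeff k)
  have hq' : ∀ i k (x : (Σ i : Fin d, Fin (t i)) → ℝ), MvPolynomial.eval x (q i k) =
      ((-(S i 0 + ∑ a : Fin (t i), (x ⟨i, a⟩ : ℂ) • S i a.succ)).charpoly.coeff k).re := by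
    intro i k x
    rw [hq, ← hM, Matrix.charpoly_map, Polynomial.coeff_map]
  -- The characteristic polynomial has degree $n_i$, so the coefficients with index at most $n_i$
  -- suffice.
  let e := Fintype.equivFin (Σ i : Fin d, Fin (n i + 1))
  refine ⟨_, fun j => q (e.symm j).1 (e.symm j).2, ?_⟩
  ext x
  simp only [productStateSet, localStateSet, basicClosedSet, Set.mem_ofPred_eq,
    ((hS _).isHermitian_sum _).posSemidef_iff_charpoly_neg_coeff, ← hq']
  constructor
  · exact fun h j => h _ _
  · intro h i k
    by_cases hk : k < n i + 1
    · have := h (e ⟨i, ⟨k, hk⟩⟩)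
      rwa [e.symm_apply_apply] at this
    · rw [hq', Polynomial.coeff_eq_zero_of_natDegree_lt, Complex.zero_re]
      rw [Matrix.charpoly_natDegree_eq_dim, Fintype.card_fin]
      omega

end Semialgebraic

/-! ### Product states in coordinates -/

section Criterion

variable {d : ℕ} {n t : Fin d → ℕ} {S : ∀ i, Fin (t i + 1) → Matrix (Fin (n i)) (Fin (n i)) ℂ}

/-- The coordinates `(1, x^(i)_1, …, x^(i)_{t_i})` of the `i`-th factor. -/
noncomputable def homogCoord (x : (Σ i : Fin d, Fin (t i)) → ℝ) (i : Fin d) : Fin (t i + 1) → ℝ :=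
  Fin.cons 1 fun a => x ⟨i, a⟩

lemma prod_homogCoord (x : (Σ i : Fin d, Fin (t i)) → ℝ) (μ : ∀ i, Fin (t i + 1)) :
    ∏ i, homogCoord x i (μ i) = monomialEval x (coordExponent μ) := by
  have hsum : ∀ (s : Finset (Fin d)) (f : Fin d → (Σ i : Fin d, Fin (t i)) →₀ ℕ),
      monomialEval x (∑ i ∈ s, f i) = ∏ i ∈ s, monomialEval x (f i) := by
    classical
    intro s f
    induction s using Finset.induction_on with
    | empty => simp [monomialEval_zero]
    | insert i s hi ih => rw [Finset.sum_insert hi, Finset.prod_insert hi, monomialEval_add, ih]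
  rw [coordExponent, hsum]
  refine Finset.prod_congr rfl fun i _ => ?_
  refine Fin.cases ?_ (fun a => ?_) (μ i)
  · simp [homogCoord, monomialEval_zero]
  · simp [homogCoord, monomialEval_single]

/-- Each factor contributes at most one variable. Hence $2k>d$ places all prescribed moments within
the truncation. -/
lemma degree_coordExponent_le (μ : ∀ i, Fin (t i + 1)) : (coordExponent μ).degree ≤ d := by
  rw [coordExponent, map_sum]
  refine (Finset.sum_le_card_nsmul _ _ 1 fun i _ => ?_).trans (by simp)
  refine Fin.cases ?_ (fun a => ?_) (μ i)
  · simp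
  · simp [Finsupp.degree_single]

/-- The local operator with Bloch vector `x^(i)`, normalized to unit trace. -/
noncomputable def localOperator (S : ∀ i, Fin (t i + 1) → Matrix (Fin (n i)) (Fin (n i)) ℂ)
    (x : (Σ i : Fin d, Fin (t i)) → ℝ) (i : Fin d) : Matrix (Fin (n i)) (Fin (n i)) ℂ :=
  (n i : ℂ)⁻¹ • ∑ a, (homogCoord x i a : ℂ) • S i a

lemma sum_homogCoord_smul (x : (Σ i : Fin d, Fin (t i)) → ℝ) (i : Fin d) :
    ∑ a, (homogCoord x i a : ℂ) • S i a =
      S i 0 + ∑ a : Fin (t i), (x ⟨i, a⟩ : ℂ) • S i a.succ := by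
  rw [Fin.sum_univ_succ]
  simp [homogCoord]

lemma operatorOfCoords_monomialEval (hS : ∀ i, IsHermitianOperatorBasis (S i))
    (x : (Σ i : Fin d, Fin (t i)) → ℝ) :
    operatorOfCoords S (fun μ => monomialEval x (coordExponent μ)) =
      tensorMatrix (localOperator S x) := by
  simp only [← prod_homogCoord]
  exact operatorOfCoords_prod hS (homogCoord x)

lemma localOperator_isDensityMatrix (hS : ∀ i, IsHermitianOperatorBasis (S i))
    {x : (Σ i : Fin d, Fin (t i)) → ℝ} (hx : x ∈ productStateSet S) (i : Fin d) :
    IsDensityMatrix (localOperator S x i) := by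
  rw [localOperator, sum_homogCoord_smul]
  have hn : (n i : ℂ) ≠ 0 := Nat.cast_ne_zero.mpr (hS i).size_pos.ne'
  refine ⟨?_, ?_⟩
  · have h : (S i 0 + ∑ a : Fin (t i), (x ⟨i, a⟩ : ℂ) • S i a.succ).PosSemidef := hx i
    refine h.smul ?_
    rw [← Complex.ofReal_natCast, ← Complex.ofReal_inv]
    exact Complex.zero_le_real.mpr (by positivity)
  · rw [Matrix.trace_smul, (hS i).trace_local fun a => x ⟨i, a⟩, smul_eq_mul, inv_mul_cancel₀ hn]

lemma exists_localOperator_eq (hS : ∀ i, IsHermitianOperatorBasis (S i))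
    {σ : ∀ i, Matrix (Fin (n i)) (Fin (n i)) ℂ} (hσ : ∀ i, IsDensityMatrix (σ i)) :
    ∃ x ∈ productStateSet S, localOperator S x = σ := by
  choose a ha using fun i => exists_real_coords_of_isHermitian (hS i).isHermitian
    (hS i).linearIndependent (hS i).span_eq_top (hσ i).1.isHermitian
  have hn : ∀ i, (n i : ℂ) ≠ 0 := fun i => Nat.cast_ne_zero.mpr (hS i).size_pos.ne'
  -- Only $S_0$ has nonzero trace, so unit trace fixes the zeroth coordinate as $1/n_i$. Rescaling
  -- by $n_i$ gives the leading coordinate $1$ required in $K$.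
  have h0 : ∀ i, (n i : ℂ) * (a i 0 : ℂ) = 1 := by
    intro i
    have h := (hσ i).2
    rw [ha i, (hS i).trace_sum fun μ => (a i μ : ℂ)] at h
    rw [mul_comm, h]
  let x : (Σ i : Fin d, Fin (t i)) → ℝ := fun p => (n p.1 : ℝ) * a p.1 p.2.succ
  have hsum : ∀ i, ∑ μ, (homogCoord x i μ : ℂ) • S i μ = (n i : ℂ) • σ i := by
    intro i
    rw [ha i, Finset.smul_sum]
    refine Finset.sum_congr rfl fun μ _ => ?_
    rw [smul_smul]
    congr 1
    refine Fin.cases ?_ (fun b => ?_) μ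
    · rw [h0]
      simp [homogCoord]
    · simp [homogCoord, x]
  refine ⟨x, fun i => ?_, funext fun i => ?_⟩
  · change (S i 0 + ∑ b : Fin (t i), (x ⟨i, b⟩ : ℂ) • S i b.succ).PosSemidef
    rw [← sum_homogCoord_smul, hsum]
    refine (hσ i).1.smul ?_
    exact_mod_cast Nat.zero_le (n i)
  · rw [localOperator, hsum, smul_smul, inv_mul_cancel₀ (hn i), one_smul]

/-- Separability in coordinates: the coordinates are moments of a finite atomic measure on `K`. -/
lemma isSeparableState_operatorOfCoords_iff (hS : ∀ i, IsHermitianOperatorBasis (S i))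
    (X : (∀ i, Fin (t i + 1)) → ℝ) :
    IsSeparableState (operatorOfCoords S X) ↔
      ∃ (r : ℕ) (w : Fin r → ℝ) (x : Fin r → (Σ i : Fin d, Fin (t i)) → ℝ),
        (∀ j, 0 ≤ w j) ∧ (∀ j, x j ∈ productStateSet S) ∧
          ∀ μ, X μ = ∑ j, w j * monomialEval (x j) (coordExponent μ) := by
  constructor
  · rintro ⟨r, w, σ, hw, hσ, h⟩
    choose x hx hxσ using fun j => exists_localOperator_eq hS (hσ j)
    have key : operatorOfCoords S X = operatorOfCoords S fun μ =>
        ∑ j, w j * monomialEval (x j) (coordExponent μ) := by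
      rw [h, operatorOfCoords_sum w fun j μ => monomialEval (x j) (coordExponent μ)]
      simp only [operatorOfCoords_monomialEval hS, hxσ]
    exact ⟨r, w, x, hw, hx, congrFun (operatorOfCoords_injective hS key)⟩
  · rintro ⟨r, w, x, hw, hx, h⟩
    refine ⟨r, w, fun j => localOperator S (x j), hw,
      fun j => localOperator_isDensityMatrix hS (hx j), ?_⟩
    rw [funext h, operatorOfCoords_sum w fun j μ => monomialEval (x j) (coordExponent μ)]
    simp only [operatorOfCoords_monomialEval hS]

end Criterion

theorem theorem2 {d : ℕ} (n t : Fin d → ℕ)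
    (S : ∀ i, Fin (t i + 1) → Matrix (Fin (n i)) (Fin (n i)) ℂ)
    (hS : ∀ i, IsHermitianOperatorBasis (S i))
    (ρ : Matrix (∀ i, Fin (n i)) (∀ i, Fin (n i)) ℂ) (hρ : IsDensityMatrix ρ) :
    -- the coordinates of `ρ` exist and are unique
    (∃! X : (∀ i, Fin (t i + 1)) → ℝ, ρ = operatorOfCoords S X) ∧
    -- `K` is compact and semi-algebraic
    IsCompact (productStateSet S) ∧
    (∃ (m : ℕ) (g : Fin m → MvPolynomial (Σ i : Fin d, Fin (t i)) ℝ),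
      productStateSet S = basicClosedSet g) ∧
    -- the criterion, for every description of `K` by polynomial inequalities
    ∀ (X : (∀ i, Fin (t i + 1)) → ℝ), ρ = operatorOfCoords S X →
      ∀ (m : ℕ) (g : Fin m → MvPolynomial (Σ i : Fin d, Fin (t i)) ℝ),
        productStateSet S = basicClosedSet g →
        (IsSeparableState ρ ↔
          ∃ y : TruncSeq (coordExponents t),
            (∀ μ, y ⟨coordExponent μ, Set.mem_range_self μ⟩ = X μ) ∧
            ∃ (k : ℕ) (z : TruncSeqLE (Σ i : Fin d, Fin (t i)) (2 * k)),
              IsFlatExtension d g y z ∧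
              (momentMatrix k z.val).PosSemidef ∧
              ∀ i, (momentMatrix (k - halfDegree (g i)) (shiftedSeq (g i) z.val)).PosSemidef) := by
  refine ⟨?_, isCompact_productStateSet hS, exists_basicClosedSet_eq_productStateSet hS, ?_⟩
  · obtain ⟨X, hX⟩ := exists_operatorOfCoords_eq hS hρ.1.isHermitian
    exact ⟨X, hX, fun Y hY => operatorOfCoords_injective hS (hY.symm.trans hX)⟩
  rintro X rfl m g hg
  rw [isSeparableState_operatorOfCoords_iff hS]
  constructor
  · rintro ⟨r, w, x, hw, hx, hX⟩
    obtain ⟨k, z, hdk, hk, hz, hrank, hpsd, hloc⟩ :=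
      exists_flat_of_atoms g hw (fun j => hg ▸ hx j) d
    -- Defining `y` by moments at the exponent itself makes it well defined on $\mathcal A$ without
    -- comparing tuples with equal exponents.
    refine ⟨fun α => ∑ j, w j * monomialEval (x j) α.1, fun μ => (hX μ).symm, k, z,
      ⟨hdk, ?_, hk, hrank⟩, hpsd, hloc⟩
    rintro ⟨_, μ, rfl⟩
    exact hz _ ((degree_coordExponent_le μ).trans hdk.le)
  · rintro ⟨y, hy, k, z, hflat, hpsd, hloc⟩
    have hk := hflat.order_le
    have h1 := one_le_flatOrder g
    obtain ⟨F, w, hw, hz, hF⟩ := exists_atoms_mem_of_flat (j := k - flatOrder g) (by omega) g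
      (fun i => by have := halfDegree_le_flatOrder g i; omega) hpsd hflat.rank_eq hloc
    let e := F.equivFin.symm
    refine ⟨F.card, fun j => w (e j), fun j => e j, fun j => (hw _ (e j).2).le,
      fun j => hg ▸ hF _ (e j).2, fun μ => ?_⟩
    rw [← hy μ, ← hflat.extends_eq,
      hz _ ((degree_coordExponent_le μ).trans hflat.degree_lt.le), ← Finset.sum_coe_sort,
      ← e.sum_comp]
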